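/- Conventions. A $\lambda$-ring is a commutative ring $R$ with operations $\lambda^n\colon R\to R$ ($n\ge 0$) such that $\lambda^0(x)=1$, $\lambda^1(x)=x$, $\lambda^n(x+y)=\sum_{i+j=n}\lambda^i(x)\lambda^j(y)$, $\lambda^n(1)=0$ for $n\ge 2$, and $\lambda^n(xy)$ and $\lambda^m(\lambda^n(x))$ are given by the usual universal integer polynomials $P_n(\lambda^1x,\dots,\lambda^nx;\lambda^1y,\dots,\lambda^ny)$ and $P_{m,n}(\lambda^1x,\dots,\lambda^{mn}x)$ (a "special $\lambda$-ring" in older terminology). For a partition $\mu$ with conjugate $\mu'$ having $c$ parts, let $s_\mu=\det(e_{\mu'_i+j-i})_{1\le i,j\le c}$ be the Schur function in the ring of symmetric functions $\Lambda=\mathbb{Z}[e_1,e_2,\dots]$ (with $e_0=1$ and $e_k=0$ for $k<0$), and for $x\in R$ let $s_\mu(x)\in R$ be its image under the ring homomorphism $\Lambda\to R$ with $e_n\mapsto\lambda^n(x)$. An element $x\in R$ has bound $\mu$ if $s_\nu(x)=0$ for every partition $\nu$ whose Young diagram contains that of $\mu$; it is Schur-finite if it has some bound. A line element is an element $\ell$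 with $\lambda^n(\ell)=0$ for all $n>1$. An element $y$ is even if $\lambda^n(y)=0$ for all sufficiently large $n$, and an element is finite-dimensional if it is a difference of two even elements. Theorem. Let $R$ be a $\lambda$-ring and let $x\in R$ be a (Schur-finite) element with bound $(2,1)$. Then there exist a $\lambda$-ring $R'$, an injective homomorphism of $\lambda$-rings $R\hookrightarrow R'$, and line elements $\ell_1,\ell_2,a\in R'$ such that $x=\ell_1+\ell_2-a$ in $R'$. So the virtual splitting principle holds for elements with bound the hook $(2,1)$: $x$ is a difference of sums of line elements in $R'$, and in particular it is finite-dimensional in $R'$. -/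

import Mathlib

universe u

section UniversalPolynomials

/-- The `n`-th elementary symmetric polynomial of the finite family `(f i)_{i ∈ s}`. -/
def elemSymm {ι A : Type*} [CommRing A] (s : Finset ι) (f : ι → A) (n : ℕ) : A :=
  ∑ T ∈ s.powersetCard n, ∏ i ∈ T, f i

/-- `P(e₁, …, eₙ; f₁, …, fₙ) = eₙ({ξᵢ ηⱼ})`, that is, the coefficient of `tⁿ` in
`∏ᵢⱼ (1 + ξᵢ ηⱼ t)`. Here `eᵢ`, `fⱼ` are the elementary symmetric polynomials in the independent
variables `ξ₁, …, ξₙ` and `η₁, …, ηₙ`. The variable of `P` with index `i : Fin n` stands for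
the elementary symmetric polynomial of degree `i + 1`. -/
def IsMulPoly (n : ℕ) (P : MvPolynomial (Fin n ⊕ Fin n) ℤ) : Prop :=
  MvPolynomial.aeval
      (Sum.elim
        (fun i : Fin n =>
          elemSymm Finset.univ
            (fun k : Fin n => (MvPolynomial.X (Sum.inl k) : MvPolynomial (Fin n ⊕ Fin n) ℤ))
            (i + 1))
        (fun j : Fin n =>
          elemSymm Finset.univ
            (fun k : Fin n => (MvPolynomial.X (Sum.inr k) : MvPolynomial (Fin n ⊕ Fin n) ℤ))
            (j + 1))) P =
    elemSymm (Finset.univ : Finset (Fin n × Fin n))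
      (fun c => (MvPolynomial.X (Sum.inl c.1) * MvPolynomial.X (Sum.inr c.2) :
        MvPolynomial (Fin n ⊕ Fin n) ℤ)) n

/-- `P(e₁, …, e_{mn}) = e_m({ξ_{i₁} ⋯ ξ_{iₙ} : i₁ < ⋯ < iₙ})`, that is, the coefficient of `t^m`
in `∏_{i₁ < ⋯ < iₙ} (1 + ξ_{i₁} ⋯ ξ_{iₙ} t)`. Here `eᵢ` are the elementary symmetric polynomials
in the independent variables `ξ₁, …, ξ_{mn}`. -/
def IsCompPoly (m n : ℕ) (P : MvPolynomial (Fin (m * n)) ℤ) : Prop :=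
  MvPolynomial.aeval
      (fun i : Fin (m * n) =>
        elemSymm Finset.univ
          (fun k : Fin (m * n) => (MvPolynomial.X k : MvPolynomial (Fin (m * n)) ℤ)) (i + 1)) P =
    elemSymm (Finset.powersetCard n (Finset.univ : Finset (Fin (m * n))))
      (fun S => ∏ i ∈ S, (MvPolynomial.X i : MvPolynomial (Fin (m * n)) ℤ)) m

theorem elemSymm_X_eq_esymm (σ A : Type*) [Fintype σ] [CommRing A] (n : ℕ) :
    elemSymm Finset.univ (fun k : σ => (MvPolynomial.X k : MvPolynomial σ A)) n =
      MvPolynomial.esymm σ A n := rfl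

theorem map_elemSymm {ι A B : Type*} [CommRing A] [CommRing B] (φ : A →+* B) (s : Finset ι)
    (f : ι → A) (n : ℕ) : φ (elemSymm s f n) = elemSymm s (fun i => φ (f i)) n := by
  simp [elemSymm, map_sum, map_prod]

theorem elemSymm_zero {ι A : Type*} [CommRing A] (s : Finset ι) (f : ι → A) :
    elemSymm s f 0 = 1 := by
  simp [elemSymm]

theorem coeff_prod_one_add {ι A : Type*} [CommRing A] [DecidableEq ι] (s : Finset ι)
    (f : ι → A) (n : ℕ) :
    (∏ i ∈ s, (1 + Polynomial.C (f i) * Polynomial.X)).coeff n = elemSymm s f n := by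
  rw [Finset.prod_one_add, Polynomial.finsetSum_coeff, elemSymm, Finset.powersetCard_eq_filter,
    Finset.sum_filter]
  refine Finset.sum_congr rfl fun T _ => ?_
  rw [Finset.prod_mul_distrib, Finset.prod_const, ← map_prod, Polynomial.coeff_C_mul_X_pow]
  simp only [eq_comm]

theorem prod_one_add_eq_sum {ι A : Type*} [CommRing A] [Fintype ι] [DecidableEq ι]
    (f : ι → A) {n : ℕ} (hn : Fintype.card ι = n) :
    ∏ i, (1 + Polynomial.C (f i) * Polynomial.X) =
      ∑ k ∈ Finset.range (n + 1),
        Polynomial.C (elemSymm Finset.univ f k) * Polynomial.X ^ k := by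
  ext d
  rw [coeff_prod_one_add, Polynomial.finsetSum_coeff]
  simp only [Polynomial.coeff_C_mul_X_pow]
  rw [Finset.sum_ite_eq]
  split_ifs with h
  · rfl
  · have : n < d := by simpa using h
    rw [elemSymm, Finset.powersetCard_eq_empty.2 (by simpa [hn] using this), Finset.sum_empty]

theorem aeval_esymm_injective (A : Type*) [CommRing A] (N : ℕ) :
    Function.Injective (MvPolynomial.aeval (R := A)
      fun i : Fin N => MvPolynomial.esymm (Fin N) A (i + 1)) := by
  intro a b hab
  apply MvPolynomial.esymmAlgHom_injective (σ := Fin N) A (n := N) (by rw [Fintype.card_fin])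
  apply Subtype.ext
  rw [MvPolynomial.esymmAlgHom_apply, MvPolynomial.esymmAlgHom_apply]
  exact hab

theorem exists_aeval_esymm_eq (A : Type*) [CommRing A] (N : ℕ) (Q : MvPolynomial (Fin N) A)
    (hQ : Q.IsSymmetric) :
    ∃ P, MvPolynomial.aeval (R := A)
      (fun i : Fin N => MvPolynomial.esymm (Fin N) A (i + 1)) P = Q := by
  obtain ⟨P, hP⟩ := MvPolynomial.esymmAlgHom_surjective (σ := Fin N) A (n := N)
    (by rw [Fintype.card_fin]) ⟨Q, hQ⟩
  refine ⟨P, ?_⟩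
  have := congrArg Subtype.val hP
  rwa [MvPolynomial.esymmAlgHom_apply] at this

theorem rename_elemSymm_powersetCard {σ : Type*} [Fintype σ] (m n : ℕ) (e : Equiv.Perm σ) :
    MvPolynomial.rename e (elemSymm (Finset.powersetCard n (Finset.univ : Finset σ))
      (fun S => ∏ i ∈ S, (MvPolynomial.X i : MvPolynomial σ ℤ)) m) =
    elemSymm (Finset.powersetCard n (Finset.univ : Finset σ))
      (fun S => ∏ i ∈ S, (MvPolynomial.X i : MvPolynomial σ ℤ)) m := by
  classical
  have h1 : MvPolynomial.rename e (elemSymm (Finset.powersetCard n (Finset.univ : Finset σ))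
      (fun S => ∏ i ∈ S, (MvPolynomial.X i : MvPolynomial σ ℤ)) m) =
      elemSymm (Finset.powersetCard n (Finset.univ : Finset σ))
        (fun S => ∏ i ∈ S, (MvPolynomial.X (e i) : MvPolynomial σ ℤ)) m := by
    simp only [elemSymm, map_sum, map_prod, MvPolynomial.rename_X]
  have h2 : ∏ S ∈ Finset.powersetCard n (Finset.univ : Finset σ),
      (1 + Polynomial.C (∏ i ∈ S, (MvPolynomial.X (e i) : MvPolynomial σ ℤ)) * Polynomial.X) =
      ∏ S ∈ Finset.powersetCard n (Finset.univ : Finset σ),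
      (1 + Polynomial.C (∏ i ∈ S, (MvPolynomial.X i : MvPolynomial σ ℤ)) * Polynomial.X) := by
    refine Finset.prod_equiv (Equiv.finsetCongr e) (fun S => ?_) (fun S _ => ?_)
    · rw [Finset.mem_powersetCard_univ, Finset.mem_powersetCard_univ, Equiv.finsetCongr_apply,
        Finset.card_map]
    · rw [Equiv.finsetCongr_apply, Finset.prod_map]
      rfl
  rw [h1, ← coeff_prod_one_add, ← coeff_prod_one_add, h2]

theorem existsUnique_isCompPoly (m n : ℕ) : ∃! P, IsCompPoly m n P := by
  obtain ⟨P, hP⟩ := exists_aeval_esymm_eq ℤ (m * n) _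
    (fun e => rename_elemSymm_powersetCard m n e)
  refine ⟨P, hP, fun P' hP' => aeval_esymm_injective ℤ (m * n) ?_⟩
  exact Eq.trans hP' hP.symm

theorem existsUnique_isMulPoly (n : ℕ) : ∃! P, IsMulPoly n P := by
  classical
  -- the polynomial in `ξ` with coefficients in `ℤ[f₁, …, fₙ]`
  let f : ℕ → MvPolynomial (Fin n) ℤ := fun k => if h : k - 1 < n then (if k = 0 then 1 else MvPolynomial.X ⟨k - 1, h⟩)
    else 1
  have hf0 : f 0 = 1 := by simp [f]
  have hfs : ∀ j : Fin n, f (j + 1) = MvPolynomial.X j := by intro j; simp [f]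
  let G : Polynomial (MvPolynomial (Fin n) (MvPolynomial (Fin n) ℤ)) := ∏ i : Fin n, ∑ k ∈ Finset.range (n + 1),
    Polynomial.C (MvPolynomial.C (f k) * MvPolynomial.X i ^ k) * Polynomial.X ^ k
  have hsym : (G.coeff n).IsSymmetric := by
    intro e
    have h1 : MvPolynomial.rename e (G.coeff n) = (G.map
        (MvPolynomial.rename (R := MvPolynomial (Fin n) ℤ) e : _ →ₐ[MvPolynomial (Fin n) ℤ] MvPolynomial (Fin n) (MvPolynomial (Fin n) ℤ)).toRingHom).coeff n := by
      simp
    rw [h1]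
    congr 1
    simp only [G, Polynomial.map_prod, Polynomial.map_sum]
    conv_rhs => rw [← Equiv.prod_comp e]
    simp
  let φ : MvPolynomial (Fin n) ℤ →ₐ[ℤ] MvPolynomial (Fin n) ℤ := MvPolynomial.aeval fun i : Fin n => MvPolynomial.esymm (Fin n) ℤ (i + 1)
  have hφ : Function.Injective φ := aeval_esymm_injective ℤ n
  let ε : MvPolynomial (Fin n) (MvPolynomial (Fin n) ℤ) →ₐ[MvPolynomial (Fin n) ℤ] MvPolynomial (Fin n) (MvPolynomial (Fin n) ℤ) :=
    MvPolynomial.aeval fun i : Fin n => MvPolynomial.esymm (Fin n) (MvPolynomial (Fin n) ℤ) (i + 1)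
  have hε : Function.Injective ε := aeval_esymm_injective (MvPolynomial (Fin n) ℤ) n
  let s := MvPolynomial.sumAlgEquiv ℤ (Fin n) (Fin n)
  let L : MvPolynomial (Fin n ⊕ Fin n) ℤ →+* MvPolynomial (Fin n) (MvPolynomial (Fin n) ℤ) :=
    (ε.toRingHom.comp (MvPolynomial.map φ.toRingHom)).comp s.toRingEquiv.toRingHom
  let L' : MvPolynomial (Fin n ⊕ Fin n) ℤ →ₐ[ℤ] MvPolynomial (Fin n ⊕ Fin n) ℤ :=
    MvPolynomial.aeval
      (Sum.elim
        (fun i : Fin n =>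
          elemSymm Finset.univ
            (fun k : Fin n => (MvPolynomial.X (Sum.inl k) : MvPolynomial (Fin n ⊕ Fin n) ℤ))
            (i + 1))
        (fun j : Fin n =>
          elemSymm Finset.univ
            (fun k : Fin n => (MvPolynomial.X (Sum.inr k) : MvPolynomial (Fin n ⊕ Fin n) ℤ))
            (j + 1)))
  have hL : ∀ P, s (L' P) = L P := by
    intro P
    have : s.toRingEquiv.toRingHom.comp L'.toRingHom = L := by
      apply MvPolynomial.ringHom_ext
      · intro r; simp
      · rintro (i | j)
        · have := map_elemSymm s.toRingEquiv.toRingHom Finset.univ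
            (fun k : Fin n => (MvPolynomial.X (Sum.inl k) : MvPolynomial (Fin n ⊕ Fin n) ℤ))
            (i + 1)
          simp [L, L', s, ε] at this ⊢
          rw [this, elemSymm_X_eq_esymm]
        · have := map_elemSymm s.toRingEquiv.toRingHom Finset.univ
            (fun k : Fin n => (MvPolynomial.X (Sum.inr k) : MvPolynomial (Fin n ⊕ Fin n) ℤ))
            (j + 1)
          have h2 := map_elemSymm (MvPolynomial.C : MvPolynomial (Fin n) ℤ →+* MvPolynomial (Fin n) (MvPolynomial (Fin n) ℤ)) Finset.univ
            (fun k : Fin n => (MvPolynomial.X k : MvPolynomial (Fin n) ℤ)) (j + 1)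
          rw [elemSymm_X_eq_esymm] at h2
          simp [L, L', s, ε, φ] at this ⊢
          rw [this]
          exact h2.symm
    exact congrArg (fun g : _ →+* _ => g P) this
  have hLinj : Function.Injective L := by
    intro a b hab
    exact s.injective (MvPolynomial.map_injective _ hφ (hε hab))
  -- the value at the elementary symmetric polynomials in `η`
  have hval : MvPolynomial.map φ.toRingHom (G.coeff n) =
      s (elemSymm (Finset.univ : Finset (Fin n × Fin n))
        (fun c => (MvPolynomial.X (Sum.inl c.1) * MvPolynomial.X (Sum.inr c.2) :
          MvPolynomial (Fin n ⊕ Fin n) ℤ)) n) := by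
    have h1 := map_elemSymm s.toRingEquiv.toRingHom Finset.univ
      (fun c : Fin n × Fin n => (MvPolynomial.X (Sum.inl c.1) * MvPolynomial.X (Sum.inr c.2) :
          MvPolynomial (Fin n ⊕ Fin n) ℤ)) n
    have h2 : ∀ p, s.toRingEquiv.toRingHom p = s p := fun _ => rfl
    rw [h2] at h1
    rw [h1, ← coeff_prod_one_add, ← Polynomial.coeff_map]
    congr 1
    simp only [G, Polynomial.map_prod, Polynomial.map_sum]
    rw [Fintype.prod_prod_type]
    refine Finset.prod_congr rfl fun i _ => ?_
    rw [prod_one_add_eq_sum _ (n := n) (by simp)]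
    refine Finset.sum_congr rfl fun k hk => ?_
    simp only [Polynomial.map_mul, Polynomial.map_C, Polynomial.map_pow, Polynomial.map_X, h2]
    congr 2
    have h3 : elemSymm Finset.univ (fun j : Fin n => s (MvPolynomial.X (Sum.inl i) *
        MvPolynomial.X (Sum.inr j))) k =
        MvPolynomial.C (MvPolynomial.esymm (Fin n) ℤ k) * MvPolynomial.X i ^ k := by
      rw [← elemSymm_X_eq_esymm, map_elemSymm]
      simp only [elemSymm, Finset.sum_mul]
      refine Finset.sum_congr rfl fun T hT => ?_
      rw [← (Finset.mem_powersetCard.1 hT).2]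
      simp [s, Finset.prod_mul_distrib, mul_comm]
    rw [h3]
    have h4 : φ (f k) = MvPolynomial.esymm (Fin n) ℤ k := by
      rcases k with _ | k
      · simp [hf0]
      · have hk' : k < n := by simpa using hk
        have := hfs ⟨k, hk'⟩
        simp only at this
        rw [this]
        simp only [φ]
        rw [MvPolynomial.aeval_X]
    simp [h4]
  obtain ⟨P₁, hP₁⟩ := exists_aeval_esymm_eq (MvPolynomial (Fin n) ℤ) n (G.coeff n) hsym
  have hP₁' : ε P₁ = G.coeff n := hP₁
  have hcomm : ∀ p, ε (MvPolynomial.map φ.toRingHom p) = MvPolynomial.map φ.toRingHom (ε p) := by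
    intro p
    have : ε.toRingHom.comp (MvPolynomial.map φ.toRingHom) =
        (MvPolynomial.map φ.toRingHom).comp ε.toRingHom := by
      apply MvPolynomial.ringHom_ext
      · intro r; simp [ε]
      · intro i; simp [ε, MvPolynomial.map_esymm]
    exact congrArg (fun g : _ →+* _ => g p) this
  have hs : L (s.symm P₁) = s (elemSymm (Finset.univ : Finset (Fin n × Fin n))
        (fun c => (MvPolynomial.X (Sum.inl c.1) * MvPolynomial.X (Sum.inr c.2) :
          MvPolynomial (Fin n ⊕ Fin n) ℤ)) n) := by
    rw [← hval, ← hP₁', ← hcomm]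
    change ε (MvPolynomial.map φ.toRingHom (s (s.symm P₁))) = _
    rw [AlgEquiv.apply_symm_apply]
  refine ⟨s.symm P₁, ?_, fun P' hP' => ?_⟩
  · apply s.injective
    exact (hL _).trans hs
  · apply hLinj
    rw [hs, ← hL]
    exact congrArg s hP'

/-- The universal polynomial `Pₙ` with `λⁿ(xy) = Pₙ(λ¹x, …, λⁿx; λ¹y, …, λⁿy)`. -/
noncomputable def mulPoly (n : ℕ) : MvPolynomial (Fin n ⊕ Fin n) ℤ :=
  (existsUnique_isMulPoly n).choose

theorem isMulPoly_mulPoly (n : ℕ) : IsMulPoly n (mulPoly n) :=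
  (existsUnique_isMulPoly n).choose_spec.1

/-- The universal polynomial `P_{m,n}` with `λᵐ(λⁿx) = P_{m,n}(λ¹x, …, λᵐⁿx)`. -/
noncomputable def compPoly (m n : ℕ) : MvPolynomial (Fin (m * n)) ℤ :=
  (existsUnique_isCompPoly m n).choose

theorem isCompPoly_compPoly (m n : ℕ) : IsCompPoly m n (compPoly m n) :=
  (existsUnique_isCompPoly m n).choose_spec.1

end UniversalPolynomials

/-- A `λ`-ring (a "special" `λ`-ring in the older terminology): a commutative ring with
operations `λⁿ` such that `λ_t = ∑ λⁿ tⁿ` is additive-to-multiplicative, `λ_t(1) = 1 + t`, and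
`λⁿ(xy)`, `λᵐ(λⁿx)` are given by the universal polynomials. -/
class LambdaRing (R : Type u) extends CommRing R where
  /-- The operation `λⁿ`. -/
  lam : ℕ → R → R
  lam_zero : ∀ x, lam 0 x = 1
  lam_one : ∀ x, lam 1 x = x
  lam_add : ∀ n x y, lam n (x + y) =
    ∑ p ∈ Finset.HasAntidiagonal.antidiagonal n, lam p.1 x * lam p.2 y
  lam_of_one : ∀ n, 2 ≤ n → lam n 1 = 0
  lam_mul : ∀ n x y, lam n (x * y) =
    MvPolynomial.aeval
      (Sum.elim (fun i : Fin n => lam (i + 1) x) (fun j : Fin n => lam (j + 1) y)) (mulPoly n)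
  lam_lam : ∀ m n x, lam m (lam n x) =
    MvPolynomial.aeval (fun i : Fin (m * n) => lam (i + 1) x) (compPoly m n)

/-- A homomorphism of `λ`-rings. -/
structure LambdaRingHom (R : Type*) (S : Type*) [LambdaRing R] [LambdaRing S] extends
    R →+* S where
  map_lam : ∀ n x, toRingHom (LambdaRing.lam n x) = LambdaRing.lam n (toRingHom x)

/-- The element `e_k` (`k ∈ ℤ`) of the ring of symmetric functions `Λ = ℤ[e₁, e₂, …]`, where the
variable with index `i` is `e_{i+1}`, `e₀ = 1`, and `e_k = 0` for `k < 0`. -/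
noncomputable def elemFn (k : ℤ) : MvPolynomial ℕ ℤ :=
  if k < 0 then 0 else if k = 0 then 1 else MvPolynomial.X (k.toNat - 1)

/-- The Schur function `s_μ = det (e_{μ'_i + j - i})` in `Λ = ℤ[e₁, e₂, …]`, where `μ'_i` are
the column lengths of `μ` and the size of the matrix is the number of columns of `μ`. -/
noncomputable def schurFn (μ : YoungDiagram) : MvPolynomial ℕ ℤ :=
  Matrix.det (Matrix.of fun i j : Fin (μ.rowLen 0) =>
    elemFn ((μ.colLen i : ℤ) + (j : ℤ) - (i : ℤ)))

section Elements

variable {R : Type*} [LambdaRing R]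

/-- The ring homomorphism `u_x : Λ → R` with `u_x(eₙ) = λⁿ(x)`. -/
noncomputable def evalSymm (x : R) : MvPolynomial ℕ ℤ →ₐ[ℤ] R :=
  MvPolynomial.aeval fun i : ℕ => LambdaRing.lam (i + 1) x

/-- `x` has bound `μ`: `s_ν(x) = 0` for every partition `ν` whose diagram contains that of `μ`. -/
def HasBound (x : R) (μ : YoungDiagram) : Prop :=
  ∀ ν : YoungDiagram, μ ≤ ν → evalSymm x (schurFn ν) = 0

/-- `ℓ` is a line element: `λⁿ(ℓ) = 0` for all `n > 1`. -/
def IsLineElement (ℓ : R) : Prop := ∀ n, 1 < n → LambdaRing.lam n ℓ = 0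

/-- `x` is even (of finite degree): `λ_t(x)` is a polynomial. -/
def IsEvenElement (x : R) : Prop := ∃ d, ∀ n, d < n → LambdaRing.lam n x = 0

/-- `x` is finite-dimensional: a difference of two even elements. -/
def IsFiniteDimElement (x : R) : Prop :=
  ∃ y z : R, IsEvenElement y ∧ IsEvenElement z ∧ x = y - z

end Elements

/-- The partition `(2, 1)`. -/
def hookTwoOne : YoungDiagram := YoungDiagram.ofRowLens [2, 1] (by decide)

/-! Among the shapes containing (2,1) are the two-column hooks with columns of lengths `n + 2` and
`1`. Their Schur functions are `e_{n+2} e_1 - e_{n+3}`, so the bound forces `λ^{n+3}(x) = x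
λ^{n+2}(x)` (`HasBound.lam_succ_eq`). Hence `λ_t(x)(1 - x t) = 1 + (λ²x - x²) t²`: beyond one linear
factor in the denominator, `λ_t(x)` is a quadratic polynomial. Over an extension `B` of `R` this
quadratic splits as `(1 + p t)(1 + q t)`.

The ring `R'` is `LambdaSeries B`, the power series `1 + ⋯` over `B`, whose addition is the product
of series. Sending `x` to `λ_t(x)` embeds `R` as a `λ`-ring, every `1 + b t` is a line element, and
the factorization reads `x = [p] + [q] - [-x]`, where `[b]` stands for `1 + b t`.

Most of the work is that such series form a `λ`-ring. By `exists_eqUpTo_ofRoots`, up to any given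
degree and after an injective extension, a series is a finite product `∏ (1 + a t)`. On such
products the universal polynomials become operations on the multiset of roots
(`aeval_mulPoly_esymm`, `aeval_compPoly_esymm`), where the axioms are clear. -/

/-! ### Elementary symmetric functions of multisets of roots -/

namespace Multiset

variable {A B : Type*} [CommRing A] [CommRing B]

theorem esymm_zero_right (s : Multiset A) : s.esymm 0 = 1 := by
  simp [esymm, powersetCard_zero_left]

theorem esymm_one_right (s : Multiset A) : s.esymm 1 = s.sum := by
  simp [esymm, powersetCard_one, Multiset.map_map]

theorem esymm_eq_zero {s : Multiset A} {n : ℕ} (h : card s < n) : s.esymm n = 0 := by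
  simp [esymm, powersetCard_eq_empty n h]

theorem map_esymm (φ : A →+* B) (s : Multiset A) (n : ℕ) :
    φ (s.esymm n) = (s.map φ).esymm n := by
  simp only [esymm, map_multiset_sum, powersetCard_map, Multiset.map_map]
  congr 1
  exact map_congr rfl fun t _ => map_multiset_prod φ t

theorem esymm_cons_succ (a : A) (s : Multiset A) (n : ℕ) :
    (a ::ₘ s).esymm (n + 1) = s.esymm (n + 1) + a * s.esymm n := by
  simp [esymm, powersetCard_cons, Multiset.map_map, sum_map_mul_left]

theorem coeff_prod_one_add (s : Multiset A) (n : ℕ) :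
    (s.map fun a => 1 + Polynomial.C a * Polynomial.X).prod.coeff n = s.esymm n := by
  induction s using Multiset.induction generalizing n with
  | empty =>
    cases n with
    | zero => simp [esymm_zero_right]
    | succ n => rw [esymm_eq_zero (by simp)]; simp [Polynomial.coeff_one]
  | cons a s ih =>
    rw [map_cons, prod_cons, add_mul, one_mul, mul_assoc, Polynomial.coeff_add,
      Polynomial.coeff_C_mul, ih]
    cases n with
    | zero => simp [esymm_zero_right]
    | succ n => rw [Polynomial.coeff_X_mul, ih, esymm_cons_succ]

theorem esymm_add (s t : Multiset A) (n : ℕ) :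
    (s + t).esymm n = ∑ p ∈ Finset.HasAntidiagonal.antidiagonal n, s.esymm p.1 * t.esymm p.2 := by
  rw [← coeff_prod_one_add, map_add, prod_add, Polynomial.coeff_mul]
  simp only [coeff_prod_one_add]

theorem esymm_add_replicate_zero (s : Multiset A) (k n : ℕ) :
    (s + replicate k 0).esymm n = s.esymm n := by
  rw [← coeff_prod_one_add, ← coeff_prod_one_add]
  simp

theorem esymm_map_mul_left (b : A) (s : Multiset A) (n : ℕ) :
    (s.map (b * ·)).esymm n = b ^ n * s.esymm n := by
  simp only [esymm, powersetCard_map, Multiset.map_map, ← sum_map_mul_left]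
  congr 1
  refine map_congr rfl fun t ht => ?_
  rw [← (mem_powersetCard.1 ht).2, Function.comp_apply, prod_map_mul]
  simp

/-- The multiset of all products `a * b` with `a ∈ s` and `b ∈ t`. -/
def products (s t : Multiset A) : Multiset A := (s ×ˢ t).map fun p => p.1 * p.2

/-- The multiset of the products over all `n`-element subsets of `s`. -/
def subsetProducts (n : ℕ) (s : Multiset A) : Multiset A := (s.powersetCard n).map prod

theorem sum_subsetProducts (n : ℕ) (s : Multiset A) : (subsetProducts n s).sum = s.esymm n := rfl

theorem zero_products (t : Multiset A) : products 0 t = 0 := by simp [products]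

theorem cons_products (a : A) (s t : Multiset A) :
    products (a ::ₘ s) t = t.map (a * ·) + products s t := by
  simp [products, cons_product, Multiset.map_map]

theorem products_comm (s t : Multiset A) : products s t = products t s := by
  rw [products, ← map_swap_product, Multiset.map_map]
  exact map_congr rfl fun p _ => mul_comm _ _

theorem products_add (s t u : Multiset A) : products s (t + u) = products s t + products s u := by
  simp [products]

theorem add_products (s t u : Multiset A) : products (s + t) u = products s u + products t u := by
  simp [products]

theorem map_products {F : Type*} [FunLike F A B] [MonoidHomClass F A B] (φ : F) (s t : Multiset A) :
    (products s t).map φ = products (s.map φ) (t.map φ) := by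
  induction s using Multiset.induction with
  | empty => simp [zero_products]
  | cons a s ih => simp [cons_products, ih, Multiset.map_map]

theorem map_mul_left_products (a : A) (s t : Multiset A) :
    (products s t).map (a * ·) = products (s.map (a * ·)) t := by
  induction s using Multiset.induction with
  | empty => simp [zero_products]
  | cons b s ih => simp [cons_products, ih, Multiset.map_map, mul_assoc]

theorem products_assoc (s t u : Multiset A) :
    products (products s t) u = products s (products t u) := by
  induction s using Multiset.induction with
  | empty => simp [zero_products]
  | cons a s ih => rw [cons_products, cons_products, add_products, ih, map_mul_left_products]

theorem one_products (s : Multiset A) : products {1} s = s := by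
  rw [← cons_zero, cons_products, zero_products]
  simp

theorem map_subsetProducts {F : Type*} [FunLike F A B] [MonoidHomClass F A B] (φ : F) (n : ℕ) (s : Multiset A) :
    (subsetProducts n s).map φ = subsetProducts n (s.map φ) := by
  simp only [subsetProducts, powersetCard_map, Multiset.map_map]
  exact map_congr rfl fun t _ => map_multiset_prod φ t

theorem subsetProducts_cons_zero (n : ℕ) (s : Multiset A) (k : ℕ) :
    (subsetProducts n (0 ::ₘ s)).esymm k = (subsetProducts n s).esymm k := by
  cases n with
  | zero => simp [subsetProducts, powersetCard_zero_left]
  | succ n =>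
    have h : subsetProducts (n + 1) (0 ::ₘ s) =
        subsetProducts (n + 1) s + replicate (card (powersetCard n s)) 0 := by
      simp [subsetProducts, powersetCard_cons, Multiset.map_map]
    rw [h, esymm_add_replicate_zero]

theorem subsetProducts_add_replicate_zero (n : ℕ) (s : Multiset A) (j k : ℕ) :
    (subsetProducts n (s + replicate j 0)).esymm k = (subsetProducts n s).esymm k := by
  induction j with
  | zero => simp
  | succ j ih => rw [replicate_succ, add_cons, subsetProducts_cons_zero, ih]

/-- Each root `a` of `t` contributes a factor with coefficients `a^k e_k(s)`, so coefficients of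
degree at most `n` depend only on `e_k(s)` with `k ≤ n`. -/
theorem esymm_products_congr {n : ℕ} {s s' : Multiset A} (t : Multiset A)
    (h : ∀ k ≤ n, s.esymm k = s'.esymm k) :
    ∀ k ≤ n, (products t s).esymm k = (products t s').esymm k := by
  induction t using Multiset.induction with
  | empty => simp [zero_products]
  | cons a t ih =>
    intro k hk
    rw [cons_products, cons_products, esymm_add, esymm_add]
    refine Finset.sum_congr rfl fun p hp => ?_
    have hp' := Finset.HasAntidiagonal.mem_antidiagonal.1 hp
    rw [esymm_map_mul_left, esymm_map_mul_left, h _ (by omega), ih _ (by omega)]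

theorem exists_eq_map_univ {A : Type*} {N : ℕ} (s : Multiset A) (h : card s = N) :
    ∃ ξ : Fin N → A, s = (Finset.univ : Finset (Fin N)).val.map ξ := by
  subst h
  refine ⟨fun i => s.toList.get (i.cast (length_toList s).symm), ?_⟩
  have : List.ofFn (fun i : Fin (card s) => s.toList.get (i.cast (length_toList s).symm)) =
      s.toList := by
    apply List.ext_get <;> simp
  rw [Fin.univ_val_map, this, coe_toList]

theorem esymm_map_univ {ι : Type*} (s : Finset ι) (ξ : ι → A) (n : ℕ) :
    (s.val.map ξ).esymm n = elemSymm s ξ n :=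
  Finset.esymm_map_val ξ s n

theorem subsetProducts_map_univ {ι : Type*} (s : Finset ι) (ξ : ι → A) (n : ℕ) :
    subsetProducts n (s.val.map ξ) = (s.powersetCard n).val.map fun S => ∏ i ∈ S, ξ i := by
  have h := Finset.map_val_val_powersetCard s n
  simp only [subsetProducts, powersetCard_map, Multiset.map_map, ← h]
  rfl

end Multiset

/-! ### Splitting monic polynomials over extensions of an arbitrary commutative ring -/

section Splitting

open Polynomial

universe v

/-- A monic polynomial of positive degree divides no nonzero constant, even in the presence of zero
divisors. -/
theorem Polynomial.Monic.injective_adjoinRoot_of {A : Type*} [CommRing A] {p : A[X]}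
    (hp : p.Monic) (h : 0 < p.natDegree) : Function.Injective (AdjoinRoot.of p) := by
  rw [injective_iff_map_eq_zero]
  intro c hc
  rw [← AdjoinRoot.mk_C, AdjoinRoot.mk_eq_zero] at hc
  by_contra hne
  exact hp.not_dvd_of_natDegree_lt (C_ne_zero.2 hne) (by simpa using h) hc

/-- Adjoin one root, divide by the linear factor, and repeat with the monic quotient. -/
theorem Polynomial.Monic.exists_prod_X_add_C (N : ℕ) {A : Type v} [CommRing A] {p : A[X]}
    (hp : p.Monic) (h : p.natDegree = N) :
    ∃ (B : Type v) (_ : CommRing B) (φ : A →+* B) (s : Multiset B), Function.Injective φ ∧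
      Multiset.card s = N ∧ p.map φ = (s.map fun b => X + C b).prod := by
  induction N generalizing A with
  | zero =>
    refine ⟨A, inferInstance, RingHom.id A, 0, Function.injective_id, rfl, ?_⟩
    simp [hp.natDegree_eq_zero.1 h]
  | succ N ih =>
    have hinj := hp.injective_adjoinRoot_of (by omega)
    have : Nontrivial A := by
      by_contra hA
      rw [not_nontrivial_iff_subsingleton] at hA
      simp [Subsingleton.elim p 0] at h
    have : Nontrivial (AdjoinRoot p) := hinj.nontrivial
    set r := AdjoinRoot.root p
    set q := p.map (AdjoinRoot.of p) /ₘ (X - C r)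
    have hq : (X - C r) * q = p.map (AdjoinRoot.of p) :=
      mul_divByMonic_eq_iff_isRoot.2 (AdjoinRoot.isRoot_root p)
    have hqm : q.Monic := (monic_X_sub_C r).of_mul_monic_left (by rw [hq]; exact hp.map _)
    have hqd : q.natDegree = N := by
      rw [natDegree_divByMonic _ (monic_X_sub_C r), hp.natDegree_map, h, natDegree_X_sub_C]
      rfl
    obtain ⟨B, _, φ, s, hφ, hs, hqs⟩ := ih hqm hqd
    refine ⟨B, inferInstance, φ.comp (AdjoinRoot.of p), (-φ r) ::ₘ s, hφ.comp hinj, by simp [hs],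
      ?_⟩
    rw [← Polynomial.map_map, ← hq, Polynomial.map_mul, hqs]
    simp [sub_eq_add_neg]

/-- Vieta's formulas for the roots of `X^N + a_1 X^{N-1} + ⋯ + a_N`. This supplies formal roots for
any sequence of coefficients, up to degree `N`. -/
theorem exists_esymm_eq {A : Type v} [CommRing A] (N : ℕ) (a : ℕ → A) (ha : a 0 = 1) :
    ∃ (B : Type v) (_ : CommRing B) (φ : A →+* B) (s : Multiset B), Function.Injective φ ∧
      Multiset.card s = N ∧ ∀ k ≤ N, s.esymm k = φ (a k) := by
  -- Over the zero ring `X ^ N` does not have degree `N`, so this case is separate.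
  rcases subsingleton_or_nontrivial A with hA | hA
  · exact ⟨A, inferInstance, RingHom.id A, Multiset.replicate N 0, Function.injective_id, by simp,
      fun k _ => Subsingleton.elim _ _⟩
  · let r : A[X] := ∑ k ∈ Finset.range N, C (a (N - k)) * X ^ k
    have hr : r.degree < N := by
      refine (degree_sum_le _ _).trans_lt ((Finset.sup_lt_iff (WithBot.bot_lt_coe N)).2 ?_)
      intro k hk
      exact (degree_C_mul_X_pow_le _ _).trans_lt (Nat.cast_lt.2 (Finset.mem_range.1 hk))
    obtain ⟨B, _, φ, s, hφ, hs, hps⟩ :=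
      (monic_X_pow_add hr).exists_prod_X_add_C N
        (natDegree_eq_of_degree_eq_some
          ((degree_add_eq_left_of_degree_lt (by rwa [degree_X_pow])).trans (degree_X_pow N)))
    refine ⟨B, inferInstance, φ, s, hφ, hs, fun k hk => ?_⟩
    have h := s.prod_X_add_C_coeff (k := N - k) (by omega)
    rw [hs, Nat.sub_sub_self hk, ← hps, coeff_map] at h
    rw [← h]
    congr 1
    simp only [r, coeff_add, coeff_X_pow, finsetSum_coeff, coeff_C_mul_X_pow, Finset.sum_ite_eq,
      Finset.mem_range]
    rcases Nat.eq_zero_or_pos k with rfl | hk0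
    · simp [ha]
    · rw [if_neg (by omega), if_pos (by omega), Nat.sub_sub_self hk, zero_add]

end Splitting

/-! ### The universal polynomials evaluated at multisets of roots -/

section UniversalIdentities

open Multiset

variable {A : Type*} [CommRing A]

theorem map_aeval_int {σ B : Type*} [CommRing B] [Algebra ℤ A] [Algebra ℤ B] (φ : A →+* B)
    (f : σ → A) (p : MvPolynomial σ ℤ) :
    φ (MvPolynomial.aeval f p) = MvPolynomial.aeval (fun i => φ (f i)) p := by
  rw [MvPolynomial.aeval_def, MvPolynomial.aeval_def, MvPolynomial.eval₂_comp_left]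
  congr 1
  exact RingHom.ext_int _ _

theorem aeval_mulPoly_elemSymm {n : ℕ} (ξ η : Fin n → A) :
    MvPolynomial.aeval (Sum.elim (fun i : Fin n => elemSymm Finset.univ ξ (i + 1))
      (fun j : Fin n => elemSymm Finset.univ η (j + 1))) (mulPoly n) =
    elemSymm (Finset.univ : Finset (Fin n × Fin n)) (fun c => ξ c.1 * η c.2) n := by
  let φ : MvPolynomial (Fin n ⊕ Fin n) ℤ →+* A :=
    (MvPolynomial.aeval (Sum.elim ξ η) : _ →ₐ[ℤ] A).toRingHom
  have h := congrArg φ (isMulPoly_mulPoly n)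
  rw [map_aeval_int, map_elemSymm] at h
  simp only [φ, AlgHom.toRingHom_eq_coe, RingHom.coe_coe, map_mul, MvPolynomial.aeval_X,
    Sum.elim_inl, Sum.elim_inr] at h
  rw [← h]
  congr 2
  funext i
  rcases i with i | i <;> simp [elemSymm]

/-- The defining identity of `mulPoly n` concerns exactly `n` roots on each side. Both sides depend
only on the `e_k` with `k ≤ n`, so two successive injective extensions allow replacing `s` and `t`
by multisets of `n` roots. -/
theorem aeval_mulPoly_esymm (n : ℕ) (s t : Multiset A) :
    MvPolynomial.aeval (Sum.elim (fun i : Fin n => s.esymm (i + 1))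
      (fun j : Fin n => t.esymm (j + 1))) (mulPoly n) = (products s t).esymm n := by
  obtain ⟨B, _, φ, s', hφ, hs', hs⟩ := exists_esymm_eq n s.esymm s.esymm_zero_right
  obtain ⟨C, _, ψ, t', hψ, ht', ht⟩ :=
    exists_esymm_eq n (fun k => φ (t.esymm k)) (by simp [esymm_zero_right])
  have hs2 : ∀ k ≤ n, (s'.map ψ).esymm k = ((s.map φ).map ψ).esymm k := by
    intro k hk
    rw [← map_esymm, hs k hk, map_esymm, map_esymm]
  have ht2 : ∀ k ≤ n, t'.esymm k = ((t.map φ).map ψ).esymm k := by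
    intro k hk
    rw [ht k hk, map_esymm, map_esymm]
  apply hφ
  apply hψ
  rw [map_aeval_int, map_aeval_int, map_esymm, map_esymm]
  have hprod : ((products s t).map φ).map ψ =
      products ((s.map φ).map ψ) ((t.map φ).map ψ) := by
    rw [map_products, map_products]
  rw [hprod, ← esymm_products_congr _ ht2 n le_rfl, products_comm,
    ← esymm_products_congr _ hs2 n le_rfl, products_comm]
  obtain ⟨ξ, hξ⟩ := exists_eq_map_univ (s'.map ψ) ((card_map ψ s').trans hs')
  obtain ⟨η, hη⟩ := exists_eq_map_univ t' ht'
  have h := aeval_mulPoly_elemSymm ξ η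
  simp only [← esymm_map_univ, ← hξ, ← hη] at h
  have hu : products (s'.map ψ) t' =
      (Finset.univ : Finset (Fin n × Fin n)).val.map fun c => ξ c.1 * η c.2 := by
    rw [hξ, hη, products, ← Finset.univ_product_univ, Finset.product_val]
    simp only [SProd.sprod, product, Multiset.map_bind, Multiset.bind_map, Multiset.map_map,
      Function.comp_def]
  rw [hu, ← h]
  congr 2
  funext i
  rcases i with i | i
  · simp only [Sum.elim_inl]
    rw [hs2 _ i.2, map_esymm, map_esymm]
  · simp only [Sum.elim_inr]
    rw [ht2 _ i.2, map_esymm, map_esymm]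

theorem aeval_elemSymm {N m n : ℕ} {Q : MvPolynomial (Fin N) ℤ}
    (hQ : MvPolynomial.aeval (fun i : Fin N => elemSymm Finset.univ
      (fun k : Fin N => (MvPolynomial.X k : MvPolynomial (Fin N) ℤ)) (i + 1)) Q =
      elemSymm (Finset.powersetCard n (Finset.univ : Finset (Fin N)))
        (fun S => ∏ i ∈ S, (MvPolynomial.X i : MvPolynomial (Fin N) ℤ)) m)
    (s : Multiset A) (hs : card s = N) :
    MvPolynomial.aeval (fun i : Fin N => s.esymm (i + 1)) Q = (subsetProducts n s).esymm m := by
  obtain ⟨ξ, rfl⟩ := exists_eq_map_univ s hs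
  have h := congrArg (MvPolynomial.aeval ξ : _ →ₐ[ℤ] A).toRingHom hQ
  rw [map_aeval_int, map_elemSymm] at h
  rw [subsetProducts_map_univ, esymm_map_univ]
  simp only [esymm_map_univ]
  simpa [elemSymm] using h

theorem esymm_subsetProducts_map_mul_left (m n : ℕ) (b : A) (s : Multiset A) :
    (subsetProducts n (s.map (b * ·))).esymm m = b ^ (m * n) * (subsetProducts n s).esymm m := by
  have h : subsetProducts n (s.map (b * ·)) = (subsetProducts n s).map (b ^ n * ·) := by
    simp only [subsetProducts, powersetCard_map, Multiset.map_map]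
    refine map_congr rfl fun t ht => ?_
    rw [← (mem_powersetCard.1 ht).2, Function.comp_apply, Function.comp_apply, prod_map_mul]
    simp
  rw [h, esymm_map_mul_left, ← pow_mul, mul_comm n m]

open Polynomial in
-- The value is isobaric of weight `m * n` in the roots, so no `e_k` with `k > m * n` can enter. To
-- extract this, the roots are scaled by a nilpotent variable that kills those `e_k`, and the
-- coefficient in weight `m * n` is read off.
theorem esymm_subsetProducts_congr_of_card {m n : ℕ} {s s' : Multiset A} (hc : card s = card s')
    (h : ∀ k ≤ m * n, s.esymm k = s'.esymm k) :
    (subsetProducts n s).esymm m = (subsetProducts n s').esymm m := by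
  -- `Q` plays the role of `compPoly m n` for `card s` variables in place of `m * n`.
  obtain ⟨Q, hQ⟩ := exists_aeval_esymm_eq ℤ (card s) _
    (fun e => rename_elemSymm_powersetCard m n e)
  -- The scaling takes place in `A[X]/(X^(m * n + 1))`, with `b` the class of `X`: the power `b^(m *
  -- n)` still detects elements of `A`, while higher powers vanish.
  let π := (Ideal.Quotient.mk (Ideal.span {(X : A[X]) ^ (m * n + 1)})).comp C
  let b := Ideal.Quotient.mk (Ideal.span {(X : A[X]) ^ (m * n + 1)}) X
  have hb : b ^ (m * n + 1) = 0 := by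
    rw [← map_pow]
    exact Ideal.Quotient.eq_zero_iff_mem.2 (Ideal.mem_span_singleton_self _)
  have key : (subsetProducts n ((s.map π).map (b * ·))).esymm m =
      (subsetProducts n ((s'.map π).map (b * ·))).esymm m := by
    rw [← aeval_elemSymm hQ _ (by simp), ← aeval_elemSymm hQ _ (by simp [hc])]
    congr 2
    funext i
    rw [esymm_map_mul_left, esymm_map_mul_left, ← map_esymm, ← map_esymm]
    by_cases hi : (i : ℕ) + 1 ≤ m * n
    · rw [h _ hi]
    · rw [pow_eq_zero_of_le (by omega) hb, zero_mul, zero_mul]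
  rw [esymm_subsetProducts_map_mul_left, esymm_subsetProducts_map_mul_left] at key
  have hm (u : Multiset A) : b ^ (m * n) * (subsetProducts n (u.map π)).esymm m =
      Ideal.Quotient.mk (Ideal.span {(X : A[X]) ^ (m * n + 1)})
        (C ((subsetProducts n u).esymm m) * X ^ (m * n)) := by
    rw [map_mul, map_pow, mul_comm (Ideal.Quotient.mk _ _), ← map_subsetProducts, ← map_esymm]
    rfl
  rw [hm, hm, Ideal.Quotient.eq, Ideal.mem_span_singleton, X_pow_dvd_iff] at key
  have := key (m * n) (by omega)
  simpa [sub_eq_zero] using this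

/-- Padding each multiset with as many zeros as the other has elements equalizes the cardinalities
and changes neither side. -/
theorem esymm_subsetProducts_congr {m n : ℕ} {s s' : Multiset A}
    (h : ∀ k ≤ m * n, s.esymm k = s'.esymm k) :
    (subsetProducts n s).esymm m = (subsetProducts n s').esymm m := by
  rw [← subsetProducts_add_replicate_zero n s (card s'),
    ← subsetProducts_add_replicate_zero n s' (card s)]
  refine esymm_subsetProducts_congr_of_card (by simp [add_comm]) fun k hk => ?_
  rw [esymm_add_replicate_zero, esymm_add_replicate_zero, h k hk]

theorem aeval_compPoly_esymm (m n : ℕ) (s : Multiset A) :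
    MvPolynomial.aeval (fun i : Fin (m * n) => s.esymm (i + 1)) (compPoly m n) =
      (subsetProducts n s).esymm m := by
  obtain ⟨B, _, φ, s', hφ, hs', hs⟩ := exists_esymm_eq (m * n) s.esymm s.esymm_zero_right
  apply hφ
  have h2 : ∀ k ≤ m * n, s'.esymm k = (s.map φ).esymm k := by
    intro k hk
    rw [hs k hk, map_esymm]
  rw [map_aeval_int, map_esymm, map_subsetProducts, ← esymm_subsetProducts_congr h2,
    ← aeval_elemSymm (isCompPoly_compPoly m n) s' hs']
  congr 2
  funext i
  rw [h2 _ i.2, map_esymm]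

end UniversalIdentities

/-! ### The `λ`-ring of power series with constant coefficient `1` -/

/-- The power series over `A` with constant coefficient `1`. They form a `λ`-ring, whose addition
is the multiplication of power series. -/
@[ext]
structure LambdaSeries (A : Type*) [CommRing A] where
  /-- The underlying power series. -/
  toSeries : PowerSeries A
  constantCoeff_eq : PowerSeries.constantCoeff toSeries = 1

namespace LambdaSeries

open Multiset

noncomputable section

section Operations

variable {A B : Type*} [CommRing A] [CommRing B]

/-- The coefficient of `tⁿ`. -/
def coeff (n : ℕ) (f : LambdaSeries A) : A := PowerSeries.coeff n f.toSeries

theorem coeff_zero (f : LambdaSeries A) : f.coeff 0 = 1 := by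
  rw [coeff, PowerSeries.coeff_zero_eq_constantCoeff_apply, f.constantCoeff_eq]

theorem ext_coeff {f g : LambdaSeries A} (h : ∀ n, f.coeff n = g.coeff n) : f = g :=
  LambdaSeries.ext (PowerSeries.ext h)

/-- The series with coefficients `a n`. -/
def ofCoeff (a : ℕ → A) (h : a 0 = 1) : LambdaSeries A where
  toSeries := PowerSeries.mk a
  constantCoeff_eq := by
    rw [← PowerSeries.coeff_zero_eq_constantCoeff_apply, PowerSeries.coeff_mk, h]

@[simp]
theorem coeff_ofCoeff (a : ℕ → A) (h : a 0 = 1) (n : ℕ) : (ofCoeff a h).coeff n = a n :=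
  PowerSeries.coeff_mk n a

/-- The series `∏ (1 + a t)`, where `a` runs through `s`. -/
def ofRoots (s : Multiset A) : LambdaSeries A := ofCoeff s.esymm s.esymm_zero_right

@[simp]
theorem coeff_ofRoots (s : Multiset A) (n : ℕ) : (ofRoots s).coeff n = s.esymm n :=
  coeff_ofCoeff _ _ n

instance : Zero (LambdaSeries A) := ⟨⟨1, map_one _⟩⟩

instance : One (LambdaSeries A) := ⟨ofRoots {1}⟩

instance : Add (LambdaSeries A) :=
  ⟨fun f g => ⟨f.toSeries * g.toSeries, by
    rw [map_mul, f.constantCoeff_eq, g.constantCoeff_eq, one_mul]⟩⟩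

instance : Neg (LambdaSeries A) :=
  ⟨fun f => ⟨PowerSeries.invOfUnit f.toSeries 1, by simp⟩⟩

instance : Mul (LambdaSeries A) :=
  ⟨fun f g => ofCoeff (fun n => MvPolynomial.aeval (Sum.elim (fun i : Fin n => f.coeff (i + 1))
    (fun j : Fin n => g.coeff (j + 1))) (mulPoly n)) (by
      have h := aeval_mulPoly_esymm 0 (0 : Multiset A) 0
      rw [esymm_zero_right] at h
      rw [← h]
      congr 2
      exact Subsingleton.elim _ _)⟩

/-- The operation `λⁿ` on power series. -/
def lam (n : ℕ) (f : LambdaSeries A) : LambdaSeries A :=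
  ofCoeff (fun m => MvPolynomial.aeval (fun i : Fin (m * n) => f.coeff (i + 1)) (compPoly m n)) (by
    have h := aeval_compPoly_esymm 0 n (0 : Multiset A)
    rw [esymm_zero_right] at h
    rw [← h]
    congr 2
    funext i
    exact absurd i.2 (by simp))

theorem coeff_add (f g : LambdaSeries A) (n : ℕ) : (f + g).coeff n =
    ∑ p ∈ Finset.HasAntidiagonal.antidiagonal n, f.coeff p.1 * g.coeff p.2 :=
  PowerSeries.coeff_mul n _ _

theorem coeff_mul (f g : LambdaSeries A) (n : ℕ) : (f * g).coeff n =
    MvPolynomial.aeval (Sum.elim (fun i : Fin n => f.coeff (i + 1))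
      (fun j : Fin n => g.coeff (j + 1))) (mulPoly n) :=
  coeff_ofCoeff _ _ n

theorem coeff_lam (n : ℕ) (f : LambdaSeries A) (m : ℕ) : (lam n f).coeff m =
    MvPolynomial.aeval (fun i : Fin (m * n) => f.coeff (i + 1)) (compPoly m n) :=
  coeff_ofCoeff _ _ m

theorem ofRoots_zero : ofRoots (0 : Multiset A) = 0 := by
  refine ext_coeff fun n => ?_
  rw [coeff_ofRoots, ← Multiset.coeff_prod_one_add]
  change _ = PowerSeries.coeff n 1
  simp [Polynomial.coeff_one, PowerSeries.coeff_one]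

theorem ofRoots_add (s t : Multiset A) : ofRoots (s + t) = ofRoots s + ofRoots t :=
  ext_coeff fun n => by simp [coeff_add, esymm_add]

theorem ofRoots_products (s t : Multiset A) : ofRoots (products s t) = ofRoots s * ofRoots t :=
  ext_coeff fun n => by simp [coeff_mul, aeval_mulPoly_esymm]

theorem lam_ofRoots (n : ℕ) (s : Multiset A) :
    lam n (ofRoots s) = ofRoots (subsetProducts n s) :=
  ext_coeff fun m => by simp [coeff_lam, aeval_compPoly_esymm]

theorem ofRoots_one : ofRoots ({1} : Multiset A) = 1 := rfl

/-- The map on power series induced by a ring homomorphism. -/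
def map (φ : A →+* B) (f : LambdaSeries A) : LambdaSeries B :=
  ofCoeff (fun n => φ (f.coeff n)) (by rw [coeff_zero, map_one])

@[simp]
theorem coeff_map (φ : A →+* B) (f : LambdaSeries A) (n : ℕ) :
    (map φ f).coeff n = φ (f.coeff n) :=
  coeff_ofCoeff _ _ n

theorem map_ofRoots (φ : A →+* B) (s : Multiset A) : map φ (ofRoots s) = ofRoots (s.map φ) :=
  ext_coeff fun n => by simp [map_esymm]

theorem map_add' (φ : A →+* B) (f g : LambdaSeries A) : map φ (f + g) = map φ f + map φ g :=
  ext_coeff fun n => by simp [coeff_add]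

theorem map_mul' (φ : A →+* B) (f g : LambdaSeries A) : map φ (f * g) = map φ f * map φ g := by
  refine ext_coeff fun n => ?_
  rw [coeff_map, coeff_mul, coeff_mul, map_aeval_int]
  congr 2
  funext i
  rcases i with i | i <;> simp

theorem map_lam (φ : A →+* B) (n : ℕ) (f : LambdaSeries A) : map φ (lam n f) = lam n (map φ f) :=
  ext_coeff fun m => by simp only [coeff_map, coeff_lam, map_aeval_int]

/-- The series `f` and `g` agree up to degree `N`. -/
def EqUpTo (N : ℕ) (f g : LambdaSeries A) : Prop := ∀ k ≤ N, f.coeff k = g.coeff k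

namespace EqUpTo

variable {N : ℕ} {f f' g g' h : LambdaSeries A}

theorem refl (N : ℕ) (f : LambdaSeries A) : EqUpTo N f f := fun _ _ => rfl

theorem symm (hf : EqUpTo N f g) : EqUpTo N g f := fun k hk => (hf k hk).symm

theorem trans (hf : EqUpTo N f g) (hg : EqUpTo N g h) : EqUpTo N f h :=
  fun k hk => (hf k hk).trans (hg k hk)

theorem mono {M : ℕ} (hf : EqUpTo N f g) (hM : M ≤ N) : EqUpTo M f g :=
  fun k hk => hf k (hk.trans hM)

theorem map (φ : A →+* B) (hf : EqUpTo N f g) : EqUpTo N (map φ f) (map φ g) :=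
  fun k hk => by rw [coeff_map, coeff_map, hf k hk]

theorem add (hf : EqUpTo N f f') (hg : EqUpTo N g g') : EqUpTo N (f + g) (f' + g') := by
  intro k hk
  rw [coeff_add, coeff_add]
  refine Finset.sum_congr rfl fun p hp => ?_
  have hp' := Finset.HasAntidiagonal.mem_antidiagonal.1 hp
  rw [hf _ (by omega), hg _ (by omega)]

theorem mul (hf : EqUpTo N f f') (hg : EqUpTo N g g') : EqUpTo N (f * g) (f' * g') := by
  intro k hk
  rw [coeff_mul, coeff_mul]
  congr 2
  funext i
  rcases i with i | i
  · exact hf _ (by omega)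
  · exact hg _ (by omega)

theorem lam {k n : ℕ} (hf : EqUpTo (k * n) f g) : EqUpTo k (lam n f) (lam n g) := by
  intro j hj
  rw [coeff_lam, coeff_lam]
  congr 2
  funext i
  exact hf _ (i.2.trans_le (Nat.mul_le_mul_right n hj))

end EqUpTo

end Operations

universe v

variable {A : Type v} [CommRing A]

/-- This is the splitting principle used for all axioms involving multiplication or `λ`-operations;
the extension may depend on the degree `N`. -/
theorem eq_of_forall_eqUpTo_map {f g : LambdaSeries A}
    (h : ∀ N, ∃ (B : Type v) (_ : CommRing B) (φ : A →+* B), Function.Injective φ ∧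
      EqUpTo N (map φ f) (map φ g)) : f = g := by
  refine ext_coeff fun N => ?_
  obtain ⟨B, _, φ, hφ, hB⟩ := h N
  apply hφ
  rw [← coeff_map, ← coeff_map, hB N le_rfl]

theorem exists_eqUpTo_ofRoots (N : ℕ) (f : LambdaSeries A) :
    ∃ (B : Type v) (_ : CommRing B) (φ : A →+* B) (s : Multiset B), Function.Injective φ ∧
      EqUpTo N (map φ f) (ofRoots s) := by
  obtain ⟨B, _, φ, s, hφ, -, hs⟩ := exists_esymm_eq N (fun n => f.coeff n) f.coeff_zero
  exact ⟨B, inferInstance, φ, s, hφ, fun k hk => by rw [coeff_map, coeff_ofRoots, hs k hk]⟩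

theorem map_map {B C : Type*} [CommRing B] [CommRing C] (φ : A →+* B) (ψ : B →+* C)
    (f : LambdaSeries A) : map ψ (map φ f) = map (ψ.comp φ) f :=
  ext_coeff fun n => by simp

theorem exists_eqUpTo_ofRoots₃ (N : ℕ) (f g h : LambdaSeries A) :
    ∃ (B : Type v) (_ : CommRing B) (φ : A →+* B) (s t u : Multiset B), Function.Injective φ ∧
      EqUpTo N (map φ f) (ofRoots s) ∧ EqUpTo N (map φ g) (ofRoots t) ∧
      EqUpTo N (map φ h) (ofRoots u) := by
  obtain ⟨B, _, φ, s, hφ, hs⟩ := exists_eqUpTo_ofRoots N f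
  obtain ⟨C, _, ψ, t, hψ, ht⟩ := exists_eqUpTo_ofRoots N (map φ g)
  obtain ⟨D, _, χ, u, hχ, hu⟩ := exists_eqUpTo_ofRoots N (map (ψ.comp φ) h)
  refine ⟨D, inferInstance, χ.comp (ψ.comp φ), (s.map ψ).map χ, t.map χ, u,
    hχ.comp (hψ.comp hφ), ?_, ?_, ?_⟩
  · rw [← map_ofRoots, ← map_ofRoots, ← map_map, ← map_map]
    exact (hs.map ψ).map χ
  · rw [← map_ofRoots, ← map_map, ← map_map]
    exact ht.map χ
  · rwa [← map_map]

/-- The additive axioms are those of multiplication of power series. The others reduce to identities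
between multisets of products of roots. -/
instance : CommRing (LambdaSeries A) :=
  CommRing.ofMinimalAxioms
    (fun f g h => LambdaSeries.ext (mul_assoc _ _ _))
    (fun f => LambdaSeries.ext (one_mul _))
    (fun f => LambdaSeries.ext ((mul_comm _ _).trans
      (PowerSeries.mul_invOfUnit f.toSeries 1 f.constantCoeff_eq)))
    (fun f g h => eq_of_forall_eqUpTo_map fun N => by
      obtain ⟨B, _, φ, s, t, u, hφ, hs, ht, hu⟩ := exists_eqUpTo_ofRoots₃ N f g h
      refine ⟨B, inferInstance, φ, hφ, ?_⟩
      simp only [map_mul']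
      refine ((hs.mul ht).mul hu).trans (EqUpTo.trans ?_ (hs.mul (ht.mul hu)).symm)
      simp only [← ofRoots_products, products_assoc]
      exact EqUpTo.refl _ _)
    (fun f g => eq_of_forall_eqUpTo_map fun N => by
      obtain ⟨B, _, φ, s, t, _, hφ, hs, ht, -⟩ := exists_eqUpTo_ofRoots₃ N f g 0
      refine ⟨B, inferInstance, φ, hφ, ?_⟩
      simp only [map_mul']
      refine (hs.mul ht).trans (EqUpTo.trans ?_ (ht.mul hs).symm)
      rw [← ofRoots_products, ← ofRoots_products, products_comm]
      exact EqUpTo.refl _ _)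
    (fun f => eq_of_forall_eqUpTo_map fun N => by
      obtain ⟨B, _, φ, s, hφ, hs⟩ := exists_eqUpTo_ofRoots N f
      refine ⟨B, inferInstance, φ, hφ, ?_⟩
      rw [map_mul', ← ofRoots_one, map_ofRoots, map_singleton, map_one]
      refine ((EqUpTo.refl N _).mul hs).trans (EqUpTo.trans ?_ hs.symm)
      rw [← ofRoots_products, one_products]
      exact EqUpTo.refl _ _)
    (fun f g h => eq_of_forall_eqUpTo_map fun N => by
      obtain ⟨B, _, φ, s, t, u, hφ, hs, ht, hu⟩ := exists_eqUpTo_ofRoots₃ N f g h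
      refine ⟨B, inferInstance, φ, hφ, ?_⟩
      simp only [map_mul', map_add']
      refine (hs.mul (ht.add hu)).trans (EqUpTo.trans ?_ ((hs.mul ht).add (hs.mul hu)).symm)
      simp only [← ofRoots_products, ← ofRoots_add, products_add]
      exact EqUpTo.refl _ _)

theorem map_one' {B : Type*} [CommRing B] (φ : A →+* B) : map φ (1 : LambdaSeries A) = 1 := by
  rw [← ofRoots_one, map_ofRoots, map_singleton, map_one, ofRoots_one]

/-- `LambdaSeries.map` as a ring homomorphism. -/
def mapHom {B : Type*} [CommRing B] (φ : A →+* B) : LambdaSeries A →+* LambdaSeries B :=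
  RingHom.mk' ⟨⟨map φ, map_one' φ⟩, map_mul' φ⟩ (map_add' φ)

@[simp]
theorem mapHom_apply {B : Type*} [CommRing B] (φ : A →+* B) (f : LambdaSeries A) :
    mapHom φ f = map φ f := rfl

/-- The multiplicative map `a ↦ 1 + a t`. -/
def teichmuller : A →* LambdaSeries A where
  toFun a := ofRoots {a}
  map_one' := ofRoots_one
  map_mul' a b := by rw [← ofRoots_products]; rfl

theorem ofRoots_singleton (a : A) : ofRoots {a} = teichmuller a := rfl

theorem ofRoots_eq_sum (s : Multiset A) : ofRoots s = (s.map teichmuller).sum := by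
  induction s using Multiset.induction with
  | empty => simp [ofRoots_zero]
  | cons a s ih =>
    rw [← singleton_add, ofRoots_add, ih, ofRoots_singleton, Multiset.map_add, sum_add,
      map_singleton, sum_singleton]

/-- Because `teichmuller` is multiplicative, the series of a subset product is the product of the
series of its roots. Thus `λⁿ` of a sum of line elements is their `n`-th elementary symmetric
function. -/
theorem lam_ofRoots_eq_esymm (n : ℕ) (s : Multiset A) :
    lam n (ofRoots s) = (s.map teichmuller).esymm n := by
  rw [lam_ofRoots, ofRoots_eq_sum, map_subsetProducts, sum_subsetProducts]

theorem lam_ofRoots_eq_zero {n : ℕ} {s : Multiset A} (h : card s < n) : lam n (ofRoots s) = 0 := by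
  rw [lam_ofRoots_eq_esymm, esymm_eq_zero (by simpa using h)]

theorem EqUpTo.sum {ι : Type*} {N : ℕ} {f g : ι → LambdaSeries A} {s : Finset ι}
    (h : ∀ i ∈ s, EqUpTo N (f i) (g i)) : EqUpTo N (∑ i ∈ s, f i) (∑ i ∈ s, g i) := by
  induction s using Finset.cons_induction with
  | empty => exact refl _ _
  | cons a s ha ih =>
    rw [Finset.sum_cons, Finset.sum_cons]
    exact (h a (Finset.mem_cons_self a s)).add (ih fun i hi => h i (Finset.mem_cons_of_mem hi))

theorem EqUpTo.aeval {σ : Type*} {N : ℕ} {f g : σ → LambdaSeries A}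
    (h : ∀ i, EqUpTo N (f i) (g i)) (p : MvPolynomial σ ℤ) :
    EqUpTo N (MvPolynomial.aeval f p) (MvPolynomial.aeval g p) := by
  induction p using MvPolynomial.induction_on with
  | C a => simpa using refl _ _
  | add p q hp hq => simpa using hp.add hq
  | mul_X p i hp => simpa using hp.mul (h i)

/-- After splitting, each remaining axiom is a statement about elementary symmetric functions of the
series `1 + a t`, and the universal identities apply a second time, now in `LambdaSeries B` itself.
Degree `N` of `λⁿ f` involves `f` up to degree `N * n`, which dictates the precision chosen in each
splitting. -/
instance : LambdaRing (LambdaSeries A) where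
  lam := lam
  lam_zero f := eq_of_forall_eqUpTo_map fun N => by
    obtain ⟨B, _, φ, s, hφ, hs⟩ := exists_eqUpTo_ofRoots (N * 0) f
    refine ⟨B, inferInstance, φ, hφ, ?_⟩
    rw [map_lam, map_one']
    have h := hs.lam
    rwa [lam_ofRoots_eq_esymm, esymm_zero_right] at h
  lam_one f := eq_of_forall_eqUpTo_map fun N => by
    obtain ⟨B, _, φ, s, hφ, hs⟩ := exists_eqUpTo_ofRoots (N * 1) f
    refine ⟨B, inferInstance, φ, hφ, ?_⟩
    rw [map_lam]
    have h := hs.lam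
    rw [lam_ofRoots_eq_esymm, esymm_one_right, ← ofRoots_eq_sum] at h
    exact h.trans (hs.mono (mul_one N).ge).symm
  lam_add n f g := eq_of_forall_eqUpTo_map fun N => by
    obtain ⟨B, _, φ, s, t, _, hφ, hs, ht, -⟩ := exists_eqUpTo_ofRoots₃ (N * n) f g 0
    refine ⟨B, inferInstance, φ, hφ, ?_⟩
    rw [← mapHom_apply φ (∑ _ ∈ _, _), map_sum]
    simp only [mapHom_apply, map_lam, map_add', map_mul']
    have h := (hs.add ht).lam
    rw [← ofRoots_add, lam_ofRoots_eq_esymm, Multiset.map_add, esymm_add] at h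
    refine h.trans (EqUpTo.sum fun p hp => ?_)
    have hp' := Finset.HasAntidiagonal.mem_antidiagonal.1 hp
    rw [← lam_ofRoots_eq_esymm, ← lam_ofRoots_eq_esymm]
    exact (hs.mono (Nat.mul_le_mul_left N (by omega))).lam.symm.mul
      (ht.mono (Nat.mul_le_mul_left N (by omega))).lam.symm
  lam_of_one n hn := by
    rw [← ofRoots_one]
    exact lam_ofRoots_eq_zero (by rwa [card_singleton])
  lam_mul n f g := eq_of_forall_eqUpTo_map fun N => by
    obtain ⟨B, _, φ, s, t, _, hφ, hs, ht, -⟩ := exists_eqUpTo_ofRoots₃ (N * n) f g 0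
    refine ⟨B, inferInstance, φ, hφ, ?_⟩
    rw [← mapHom_apply φ (MvPolynomial.aeval _ _), map_aeval_int, map_lam, map_mul']
    have h := (hs.mul ht).lam
    rw [← ofRoots_products, lam_ofRoots_eq_esymm, map_products, ← aeval_mulPoly_esymm] at h
    refine h.trans (EqUpTo.aeval (fun i => ?_) _)
    rcases i with i | i
    · simp only [Sum.elim_inl, mapHom_apply, map_lam, ← lam_ofRoots_eq_esymm]
      exact (hs.mono (Nat.mul_le_mul_left N i.2)).lam.symm
    · simp only [Sum.elim_inr, mapHom_apply, map_lam, ← lam_ofRoots_eq_esymm]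
      exact (ht.mono (Nat.mul_le_mul_left N i.2)).lam.symm
  lam_lam m n f := eq_of_forall_eqUpTo_map fun N => by
    obtain ⟨B, _, φ, s, hφ, hs⟩ := exists_eqUpTo_ofRoots (N * m * n) f
    refine ⟨B, inferInstance, φ, hφ, ?_⟩
    rw [← mapHom_apply φ (MvPolynomial.aeval _ _), map_aeval_int, map_lam, map_lam]
    have h := hs.lam.lam
    rw [lam_ofRoots, lam_ofRoots_eq_esymm, map_subsetProducts, ← aeval_compPoly_esymm] at h
    refine h.trans (EqUpTo.aeval (fun i => ?_) _)
    simp only [mapHom_apply, map_lam, ← lam_ofRoots_eq_esymm]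
    refine (hs.mono ?_).lam.symm
    rw [mul_assoc]
    exact Nat.mul_le_mul_left N i.2

end

end LambdaSeries

/-! ### The embedding by `λ_t` and its line elements -/

namespace LambdaSeries

open Multiset

theorem coeff_add_teichmuller_succ {A : Type*} [CommRing A] (f : LambdaSeries A) (b : A) (n : ℕ) :
    (f + teichmuller b).coeff (n + 1) = f.coeff (n + 1) + b * f.coeff n := by
  rw [coeff_add, Finset.Nat.sum_antidiagonal_succ', ← ofRoots_singleton]
  simp only [coeff_ofRoots, esymm_zero_right, mul_one]
  rw [Finset.sum_eq_single (n, 0)]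
  · simp [esymm_one_right, mul_comm]
  · rintro ⟨i, j⟩ hij hne
    have h := Finset.HasAntidiagonal.mem_antidiagonal.1 hij
    have hj : j ≠ 0 := fun h0 => hne (by simp_all)
    rw [esymm_eq_zero (by rw [card_singleton]; omega), mul_zero]
  · intro h
    exact absurd (Finset.HasAntidiagonal.mem_antidiagonal.2 (add_zero n)) h

variable (R : Type*) [LambdaRing R]

/-- The ring homomorphism `x ↦ λ_t(x)`. -/
noncomputable def ofLambdaRing : R →+* LambdaSeries R :=
  RingHom.mk'
    ⟨⟨fun x => ofCoeff (fun n => LambdaRing.lam n x) (LambdaRing.lam_zero x), by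
      refine ext_coeff fun n => ?_
      rw [← ofRoots_one, coeff_ofRoots, coeff_ofCoeff]
      rcases n with _ | _ | n
      · rw [LambdaRing.lam_zero, esymm_zero_right]
      · rw [zero_add, LambdaRing.lam_one, esymm_one_right, sum_singleton]
      · rw [LambdaRing.lam_of_one _ (by omega), esymm_eq_zero (by simp)]⟩,
      fun x y => ext_coeff fun n => by
        simp only [coeff_mul, coeff_ofCoeff, LambdaRing.lam_mul]⟩
    fun x y => ext_coeff fun n => by
      simp [coeff_add, LambdaRing.lam_add]

variable {R}

@[simp]
theorem coeff_ofLambdaRing (x : R) (n : ℕ) :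
    (ofLambdaRing R x).coeff n = LambdaRing.lam n x :=
  coeff_ofCoeff _ (LambdaRing.lam_zero x) n

theorem ofLambdaRing_lam (n : ℕ) (x : R) :
    ofLambdaRing R (LambdaRing.lam n x) = lam n (ofLambdaRing R x) :=
  ext_coeff fun m => by simp [coeff_lam, LambdaRing.lam_lam]

/-- The homomorphism of `λ`-rings `x ↦ λ_t(x)`, followed by a ring homomorphism on the
coefficients. -/
noncomputable def lambdaRingHom {B : Type*} [CommRing B] (φ : R →+* B) :
    LambdaRingHom R (LambdaSeries B) where
  toRingHom := (mapHom φ).comp (ofLambdaRing R)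
  map_lam n x := by
    change map φ (ofLambdaRing R (LambdaRing.lam n x)) = lam n (map φ (ofLambdaRing R x))
    rw [ofLambdaRing_lam, map_lam]

@[simp]
theorem coeff_lambdaRingHom {B : Type*} [CommRing B] (φ : R →+* B) (x : R) (n : ℕ) :
    ((lambdaRingHom φ).toRingHom x).coeff n = φ (LambdaRing.lam n x) := by
  change (map φ (ofLambdaRing R x)).coeff n = _
  rw [coeff_map, coeff_ofLambdaRing]

/-- The coefficient of `t` in `λ_t(x)` is `x` itself. -/
theorem lambdaRingHom_injective {B : Type*} [CommRing B] {φ : R →+* B}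
    (hφ : Function.Injective φ) : Function.Injective (lambdaRingHom φ).toRingHom := by
  intro x y h
  have h1 := congrArg (coeff 1) h
  rw [coeff_lambdaRingHom, coeff_lambdaRingHom, LambdaRing.lam_one, LambdaRing.lam_one] at h1
  exact hφ h1

theorem isLineElement_teichmuller {A : Type*} [CommRing A] (a : A) :
    IsLineElement (teichmuller a) := fun n hn => by
  rw [← ofRoots_singleton]
  exact lam_ofRoots_eq_zero (by simpa using hn)

theorem isEvenElement_ofRoots {A : Type*} [CommRing A] (s : Multiset A) :
    IsEvenElement (ofRoots s) :=
  ⟨card s, fun _ hn => lam_ofRoots_eq_zero hn⟩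

end LambdaSeries

/-! ### Two-column hooks and the recursion they impose -/

/-- The hook with `n + 1` rows and two columns, the second one of length `1`. -/
def twoColumnHook (n : ℕ) : YoungDiagram where
  cells := Finset.range (n + 1) ×ˢ {0} ∪ {(0, 1)}
  isLowerSet := by
    rintro ⟨i, j⟩ ⟨i', j'⟩ h hij
    have h1 := (Prod.mk_le_mk.1 h).1
    have h2 := (Prod.mk_le_mk.1 h).2
    simp at hij ⊢
    omega

theorem mem_twoColumnHook {n i j : ℕ} :
    (i, j) ∈ twoColumnHook n ↔ i < n + 1 ∧ j = 0 ∨ i = 0 ∧ j = 1 := by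
  rw [← YoungDiagram.mem_cells]
  simp [twoColumnHook]
  omega

theorem hookTwoOne_le_twoColumnHook {n : ℕ} (hn : 0 < n) : hookTwoOne ≤ twoColumnHook n := by
  rintro ⟨i, j⟩ h
  rw [hookTwoOne, YoungDiagram.mem_ofRowLens] at h
  obtain ⟨hi, hj⟩ := h
  rw [mem_twoColumnHook]
  simp only [List.length_cons, List.length_nil] at hi
  interval_cases i <;> simp at hj <;> omega

theorem rowLen_twoColumnHook (n : ℕ) : (twoColumnHook n).rowLen 0 = 2 := by
  have h1 := @YoungDiagram.mem_iff_lt_rowLen (twoColumnHook n) 0 1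
  have h2 := @YoungDiagram.mem_iff_lt_rowLen (twoColumnHook n) 0 2
  rw [mem_twoColumnHook] at h1 h2
  omega

theorem colLen_zero_twoColumnHook (n : ℕ) : (twoColumnHook n).colLen 0 = n + 1 := by
  have h1 := @YoungDiagram.mem_iff_lt_colLen (twoColumnHook n) n 0
  have h2 := @YoungDiagram.mem_iff_lt_colLen (twoColumnHook n) (n + 1) 0
  rw [mem_twoColumnHook] at h1 h2
  omega

theorem colLen_one_twoColumnHook (n : ℕ) : (twoColumnHook n).colLen 1 = 1 := by
  have h1 := @YoungDiagram.mem_iff_lt_colLen (twoColumnHook n) 0 1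
  have h2 := @YoungDiagram.mem_iff_lt_colLen (twoColumnHook n) 1 1
  rw [mem_twoColumnHook] at h1 h2
  omega

theorem schurFn_eq_of_rowLen_eq_two {μ : YoungDiagram} (h : μ.rowLen 0 = 2) :
    schurFn μ = elemFn (μ.colLen 0) * elemFn (μ.colLen 1) -
      elemFn (μ.colLen 0 + 1) * elemFn (μ.colLen 1 - 1) := by
  rw [schurFn, h, Matrix.det_fin_two]
  simp

theorem elemFn_natCast_succ (k : ℕ) : elemFn ((k + 1 : ℕ) : ℤ) = MvPolynomial.X k := by
  rw [elemFn, if_neg (by omega), if_neg (by omega)]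
  congr 1

/-- This is the vanishing of the `2 × 2` determinant for columns of lengths `n + 2` and `1`, whose
entries include `e_1 = x` and `e_0 = 1`. -/
theorem HasBound.lam_succ_eq {R : Type*} [LambdaRing R] {x : R} (hx : HasBound x hookTwoOne)
    (n : ℕ) : LambdaRing.lam (n + 3) x = x * LambdaRing.lam (n + 2) x := by
  have h := hx _ (hookTwoOne_le_twoColumnHook n.succ_pos)
  have h0 : elemFn 0 = 1 := by simp [elemFn]
  rw [schurFn_eq_of_rowLen_eq_two (rowLen_twoColumnHook _), colLen_zero_twoColumnHook,
    colLen_one_twoColumnHook, ← Nat.cast_succ, elemFn_natCast_succ, elemFn_natCast_succ,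
    Nat.cast_one, sub_self, h0, mul_one, ← Nat.cast_one, ← zero_add 1, elemFn_natCast_succ] at h
  simp only [evalSymm, map_sub, map_mul, MvPolynomial.aeval_X, zero_add, LambdaRing.lam_one] at h
  rw [mul_comm]
  exact (sub_eq_zero.1 h).symm

open LambdaSeries Multiset in
theorem mainTheorem4 {R : Type u} [LambdaRing R] (x : R) (hx : HasBound x hookTwoOne) :
    ∃ (R' : Type u) (_ : LambdaRing R') (f : LambdaRingHom R R'),
      Function.Injective f.toRingHom ∧
      (∃ l₁ l₂ a : R', IsLineElement l₁ ∧ IsLineElement l₂ ∧ IsLineElement a ∧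
        f.toRingHom x = l₁ + l₂ - a) ∧
      IsFiniteDimElement (f.toRingHom x) := by
  -- The values `1`, `0`, `λ²x - x²` are the coefficients of `λ_t(x)(1 - x t)` in degrees `0`, `1`,
  -- `2`; `s` consists of the two roots of this quadratic.
  obtain ⟨B, _, φ, s, hφ, hs, hroots⟩ := exists_esymm_eq 2
    (fun n => if n = 0 then 1 else if n = 1 then 0 else LambdaRing.lam 2 x - x * x) rfl
  have key : (lambdaRingHom φ).toRingHom x = ofRoots s - teichmuller (-φ x) := by
    rw [eq_sub_iff_add_eq]
    refine ext_coeff fun n => ?_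
    rw [coeff_ofRoots]
    rcases n with _ | n
    · rw [LambdaSeries.coeff_zero, esymm_zero_right]
    rw [coeff_add_teichmuller_succ, coeff_lambdaRingHom, coeff_lambdaRingHom]
    rcases n with _ | _ | n
    · simp [hroots, LambdaRing.lam_one, LambdaRing.lam_zero]
    · simp [hroots, LambdaRing.lam_one, sub_eq_add_neg]
    -- In degree `n + 3` the left side cancels by the recursion, and two roots have no elementary
    -- symmetric function there.
    · rw [hx.lam_succ_eq, map_mul, esymm_eq_zero (by omega)]
      ring
  obtain ⟨p, q, rfl⟩ := card_eq_two.1 hs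
  refine ⟨LambdaSeries B, inferInstance, lambdaRingHom φ, lambdaRingHom_injective hφ,
    ⟨teichmuller p, teichmuller q, teichmuller (-φ x), isLineElement_teichmuller p,
      isLineElement_teichmuller q, isLineElement_teichmuller _, ?_⟩,
    ⟨ofRoots {p, q}, ofRoots {-φ x}, isEvenElement_ofRoots _, isEvenElement_ofRoots _, key⟩⟩
  rw [key, ofRoots_eq_sum]
  simp
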